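/- Let $E$ be a (not necessarily unital) associative complex algebra which is a Hausdorff topological vector space with separately continuous multiplication, and suppose that its topology is determined by a directed family $(p_\alpha)_{\alpha\in\Lambda}$ of uniform seminorms, i.e. of seminorms satisfying $p_\alpha(xy)\le p_\alpha(x)p_\alpha(y)$ and $p_\alpha(x^2)=p_\alpha(x)^2$ for all $x,y\in E$ (that is, $(E,(p_\alpha)_{\alpha\in\Lambda})$ is a uniform topological algebra). Here directed means directed for the relation $\alpha\le\beta \iff p_\alpha(x)\le p_\beta(x)$ for all $x\in E$. For $\alpha\in\Lambda$ let $E_\alpha=E/\ker(p_\alpha)$ be the quotient algebra, where $\ker(p_\alpha)=\{x\in E: p_\alpha(x)=0\}$, with the norm $\|x+\ker(p_\alpha)\|=p_\alpha(x)$, and let $f_\alpha:E\to E_\alpha$, $f_\alpha(x)=x+\ker(p_\alpha)$, be the quotient map. For $\alpha\le\beta$ let $f_{\alpha\beta}:E_\beta\to E_\alpha$, $f_{\alpha\beta}(x+\ker(p_\beta))=x+\ker(p_\alpha)$. For a topological algebra $A$ let $\Delta(A)$ be the set of all nonzero continuous multiplicative linear functionals on $A$, and let $\Delta_\alpha(E)=\{\chi\in\Delta(E):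 |\chi(x)|\le p_\alpha(x)\text{ for all }x\in E\}$. Then $$\ker(f_\alpha)=\bigcap\{\ker(\chi):\chi\in\Delta_\alpha(E)\}\quad\text{for all }\alpha\in\Lambda,$$ and $$\ker(f_{\alpha\beta})=\bigcap\{\ker(\mu\circ f_{\alpha\beta}):\mu\in\Delta(E_\alpha)\}\quad\text{for all }\alpha\le\beta\text{ in }\Lambda,$$ where an empty intersection is understood as the whole space ($E$, respectively $E_\beta$). -/

import Mathlib

/-- A uniform seminorm on a (not necessarily unital) complex algebra `E`: a seminorm `p` which is
submultiplicative, `p (x * y) ≤ p x * p y`, and has the square property `p (x * x) = p x ^ 2`. -/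
structure UniformSeminorm (E : Type*) [NonUnitalRing E] [Module ℂ E] extends Seminorm ℂ E where
  mul_le' : ∀ x y : E, toFun (x * y) ≤ toFun x * toFun y
  sq' : ∀ x : E, toFun (x * x) = toFun x ^ 2

namespace UniformSeminorm

variable {E : Type*} [NonUnitalRing E] [Module ℂ E]

instance : FunLike (UniformSeminorm E) E ℝ where
  coe p := p.toFun
  coe_injective := by
    rintro ⟨p, _, _⟩ ⟨q, _, _⟩ h
    have : p = q := DFunLike.coe_injective h
    subst this
    rfl

theorem add_le (p : UniformSeminorm E) (x y : E) : p (x + y) ≤ p x + p y :=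
  map_add_le_add p.toSeminorm x y

theorem smul_eq (p : UniformSeminorm E) (c : ℂ) (x : E) : p (c • x) = ‖c‖ * p x :=
  map_smul_eq_mul p.toSeminorm c x

theorem apply_zero (p : UniformSeminorm E) : p 0 = 0 := map_zero p.toSeminorm

theorem apply_neg (p : UniformSeminorm E) (x : E) : p (-x) = p x := map_neg_eq_map p.toSeminorm x

theorem nonneg (p : UniformSeminorm E) (x : E) : 0 ≤ p x := apply_nonneg p.toSeminorm x

theorem mul_le (p : UniformSeminorm E) (x y : E) : p (x * y) ≤ p x * p y := p.mul_le' x y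

theorem eq_of_sub_eq_zero (p : UniformSeminorm E) {x y : E} (h : p (x - y) = 0) : p x = p y := by
  have h1 := p.add_le (x - y) y
  have h2 := p.add_le (-(x - y)) x
  rw [p.apply_neg] at h2
  have e : -(x - y) + x = y := by abel
  rw [e] at h2
  rw [sub_add_cancel] at h1
  linarith

/-- The kernel `{x | p x = 0}`, as a linear subspace of `E`. -/
def ker (p : UniformSeminorm E) : Submodule ℂ E where
  carrier := {x | p x = 0}
  zero_mem' := p.apply_zero
  add_mem' {x y} hx hy := le_antisymm
    ((p.add_le x y).trans (by rw [Set.mem_ofPred_eq] at hx hy; rw [hx, hy, add_zero])) (p.nonneg _)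
  smul_mem' c x hx := by
    rw [Set.mem_ofPred_eq] at hx ⊢
    rw [p.smul_eq, hx, mul_zero]

theorem mem_ker (p : UniformSeminorm E) {x : E} : x ∈ p.ker ↔ p x = 0 := Iff.rfl

theorem mul_sub_mul_mem_ker (p : UniformSeminorm E) {x x' y y' : E}
    (hx : x - x' ∈ p.ker) (hy : y - y' ∈ p.ker) : x * y - x' * y' ∈ p.ker := by
  rw [p.mem_ker] at hx hy
  have e : x * y - x' * y' = (x - x') * y + x' * (y - y') := by
    rw [sub_mul, mul_sub]; abel
  rw [p.mem_ker, e]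
  refine le_antisymm ((p.add_le _ _).trans ?_) (p.nonneg _)
  have h1 := p.mul_le (x - x') y
  have h2 := p.mul_le x' (y - y')
  rw [hx, zero_mul] at h1
  rw [hy, mul_zero] at h2
  linarith

/-- The quotient algebra `E / ker p`, with its quotient norm defined below. -/
def Factor (p : UniformSeminorm E) : Type _ := E ⧸ p.ker

instance (p : UniformSeminorm E) : AddCommGroup p.Factor :=
  inferInstanceAs (AddCommGroup (E ⧸ p.ker))

instance (p : UniformSeminorm E) : Module ℂ p.Factor :=
  inferInstanceAs (Module ℂ (E ⧸ p.ker))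

/-- The class of `x` in `E / ker p`. -/
def toFactor (p : UniformSeminorm E) (x : E) : p.Factor := Submodule.Quotient.mk x

theorem toFactor_surjective (p : UniformSeminorm E) : Function.Surjective p.toFactor :=
  Submodule.Quotient.mk_surjective p.ker

theorem toFactor_eq_toFactor (p : UniformSeminorm E) {x y : E} : p.toFactor x = p.toFactor y ↔ p (x - y) = 0 :=
  Submodule.Quotient.eq p.ker

theorem toFactor_add (p : UniformSeminorm E) (x y : E) : p.toFactor (x + y) = p.toFactor x + p.toFactor y := rfl

theorem toFactor_smul (p : UniformSeminorm E) (c : ℂ) (x : E) : p.toFactor (c • x) = c • p.toFactor x := rfl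

theorem toFactor_zero (p : UniformSeminorm E) : p.toFactor 0 = 0 := rfl

theorem toFactor_neg (p : UniformSeminorm E) (x : E) : p.toFactor (-x) = -p.toFactor x := rfl

instance (p : UniformSeminorm E) : Mul p.Factor where
  mul := Quotient.map₂ (· * ·) fun x x' hx y y' hy => by
    have hx' : x - x' ∈ p.ker := (Submodule.quotientRel_def p.ker).1 hx
    have hy' : y - y' ∈ p.ker := (Submodule.quotientRel_def p.ker).1 hy
    exact (Submodule.quotientRel_def p.ker).2 (p.mul_sub_mul_mem_ker hx' hy')

theorem toFactor_mul (p : UniformSeminorm E) (x y : E) : p.toFactor (x * y) = p.toFactor x * p.toFactor y := rfl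

/-- The norm of `E / ker p`: the norm of the class of `x` is `p x`. -/
instance (p : UniformSeminorm E) : Norm p.Factor where
  norm := Quotient.lift p fun _ _ h =>
    p.eq_of_sub_eq_zero ((Submodule.quotientRel_def p.ker).1 h)

theorem norm_toFactor (p : UniformSeminorm E) (x : E) : ‖p.toFactor x‖ = p x := rfl

instance (p : UniformSeminorm E) : NonUnitalRing p.Factor where
  left_distrib a b c := by
    obtain ⟨x, rfl⟩ := p.toFactor_surjective a
    obtain ⟨y, rfl⟩ := p.toFactor_surjective b
    obtain ⟨z, rfl⟩ := p.toFactor_surjective c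
    simp only [← toFactor_add, ← toFactor_mul, mul_add]
  right_distrib a b c := by
    obtain ⟨x, rfl⟩ := p.toFactor_surjective a
    obtain ⟨y, rfl⟩ := p.toFactor_surjective b
    obtain ⟨z, rfl⟩ := p.toFactor_surjective c
    simp only [← toFactor_add, ← toFactor_mul, add_mul]
  zero_mul a := by
    obtain ⟨x, rfl⟩ := p.toFactor_surjective a
    rw [← toFactor_zero, ← toFactor_mul, zero_mul]
  mul_zero a := by
    obtain ⟨x, rfl⟩ := p.toFactor_surjective a
    rw [← toFactor_zero, ← toFactor_mul, mul_zero]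
  mul_assoc a b c := by
    obtain ⟨x, rfl⟩ := p.toFactor_surjective a
    obtain ⟨y, rfl⟩ := p.toFactor_surjective b
    obtain ⟨z, rfl⟩ := p.toFactor_surjective c
    simp only [← toFactor_mul, mul_assoc]

theorem norm_toFactor_sub (p : UniformSeminorm E) (x y : E) :
    ‖-p.toFactor x + p.toFactor y‖ = p (x - y) := by
  rw [← p.apply_neg, neg_sub, sub_eq_neg_add]
  rfl

noncomputable instance (p : UniformSeminorm E) : MetricSpace p.Factor where
  dist a b := ‖-a + b‖
  dist_self a := by
    obtain ⟨x, rfl⟩ := p.toFactor_surjective a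
    rw [norm_toFactor_sub, sub_self, p.apply_zero]
  dist_comm a b := by
    obtain ⟨x, rfl⟩ := p.toFactor_surjective a
    obtain ⟨y, rfl⟩ := p.toFactor_surjective b
    rw [norm_toFactor_sub, norm_toFactor_sub, ← p.apply_neg, neg_sub]
  dist_triangle a b c := by
    obtain ⟨x, rfl⟩ := p.toFactor_surjective a
    obtain ⟨y, rfl⟩ := p.toFactor_surjective b
    obtain ⟨z, rfl⟩ := p.toFactor_surjective c
    rw [norm_toFactor_sub, norm_toFactor_sub, norm_toFactor_sub, ← sub_add_sub_cancel x y z]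
    exact p.add_le _ _
  eq_of_dist_eq_zero {a b} h := by
    obtain ⟨x, rfl⟩ := p.toFactor_surjective a
    obtain ⟨y, rfl⟩ := p.toFactor_surjective b
    exact p.toFactor_eq_toFactor.2 ((p.norm_toFactor_sub x y).symm.trans h)

noncomputable instance (p : UniformSeminorm E) : NonUnitalNormedRing p.Factor where
  dist_eq _ _ := rfl
  norm_mul_le a b := by
    obtain ⟨x, rfl⟩ := p.toFactor_surjective a
    obtain ⟨y, rfl⟩ := p.toFactor_surjective b
    exact p.mul_le x y

noncomputable instance (p : UniformSeminorm E) : NormedSpace ℂ p.Factor where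
  norm_smul_le c a := by
    obtain ⟨x, rfl⟩ := p.toFactor_surjective a
    exact (p.smul_eq c x).le

instance [IsScalarTower ℂ E E] (p : UniformSeminorm E) : IsScalarTower ℂ p.Factor p.Factor where
  smul_assoc c a b := by
    obtain ⟨x, rfl⟩ := p.toFactor_surjective a
    obtain ⟨y, rfl⟩ := p.toFactor_surjective b
    simp only [smul_eq_mul, ← toFactor_smul, ← toFactor_mul, smul_mul_assoc]

instance [SMulCommClass ℂ E E] (p : UniformSeminorm E) : SMulCommClass ℂ p.Factor p.Factor where
  smul_comm c a b := by
    obtain ⟨x, rfl⟩ := p.toFactor_surjective a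
    obtain ⟨y, rfl⟩ := p.toFactor_surjective b
    simp only [smul_eq_mul, ← toFactor_smul, ← toFactor_mul, mul_smul_comm]

/-- The quotient homomorphism `E → E / ker p`, `x ↦ x + ker p`. -/
def quotientHom (p : UniformSeminorm E) : E →ₙₐ[ℂ] p.Factor where
  toFun := p.toFactor
  map_smul' := p.toFactor_smul
  map_zero' := p.toFactor_zero
  map_add' := p.toFactor_add
  map_mul' := p.toFactor_mul

/-- For `p ≤ q` pointwise, the homomorphism `E / ker q → E / ker p`, `x + ker q ↦ x + ker p`. -/
def transitionHom {p q : UniformSeminorm E} (h : ∀ x, p x ≤ q x) : q.Factor →ₙₐ[ℂ] p.Factor where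
  toFun := Quotient.lift p.toFactor fun x y hxy => by
    have hq : q (x - y) = 0 := (Submodule.quotientRel_def q.ker).1 hxy
    exact p.toFactor_eq_toFactor.2 (le_antisymm ((h _).trans hq.le) (p.nonneg _))
  map_smul' c a := by
    obtain ⟨x, rfl⟩ := q.toFactor_surjective a
    rfl
  map_zero' := rfl
  map_add' a b := by
    obtain ⟨x, rfl⟩ := q.toFactor_surjective a
    obtain ⟨y, rfl⟩ := q.toFactor_surjective b
    rfl
  map_mul' a b := by
    obtain ⟨x, rfl⟩ := q.toFactor_surjective a
    obtain ⟨y, rfl⟩ := q.toFactor_surjective b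
    rfl

theorem transitionHom_toFactor {p q : UniformSeminorm E} (h : ∀ x, p x ≤ q x) (x : E) :
    transitionHom h (q.toFactor x) = p.toFactor x := rfl

/-- The set of all nonzero continuous multiplicative linear functionals `χ` on `E` such that
`|χ x| ≤ p x` for all `x`. -/
def boundedCharacters [TopologicalSpace E] (p : UniformSeminorm E) : Set (WeakDual ℂ E) :=
  {χ | χ ∈ WeakDual.characterSpace ℂ E ∧ ∀ x, ‖χ x‖ ≤ p x}

end UniformSeminorm

/-- `E` with the family `p` is a uniform topological algebra: a complex algebra which is a Hausdorff
topological vector space with separately continuous multiplication, whose topology is determined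
by the directed family `p` of uniform seminorms. -/
structure IsUniformTopologicalAlgebra {E Λ : Type*} [NonUnitalRing E] [Module ℂ E]
    [TopologicalSpace E] (p : Λ → UniformSeminorm E) : Prop where
  isTopologicalAddGroup : IsTopologicalAddGroup E
  continuousSMul : ContinuousSMul ℂ E
  t2Space : T2Space E
  separatelyContinuousMul : SeparatelyContinuousMul E
  directed : ∀ α β, ∃ γ, (∀ x, p α x ≤ p γ x) ∧ ∀ x, p β x ≤ p γ x
  withSeminorms : WithSeminorms (fun α => (p α).toSeminorm)

/-! Both identities reduce to one fact: contractive characters separate the points of a normed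
algebra `A` with `‖a * a‖ = ‖a‖ ^ 2`. It is applied to `A = E / ker p`; for the first identity the
characters are pulled back to `E`.

`A` is not assumed commutative, and proving that it is commutative is the main step. Embed `A`
isometrically in a unital Banach algebra `B`, the completed unitization. The closure `S` of `A` is a
two-sided ideal on which the square identity persists, so norm equals spectral radius on `S`.
Conjugation by a unit preserves both `S` and the spectrum, hence the norm of each element of `S`,
and Liouville's theorem makes these elements central (`commute_of_norm_mul_self`). Scalars and `A`
span a dense subspace, so `B` is commutative. Gelfand theory then gives, for each `a` in `A`, a
character of `B` of modulus `‖a‖` at `a`. -/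

open scoped ENNReal NNReal

/-! ### Spectral radius and centrality in Banach algebras. -/

section UniformNorm

variable {B : Type*} [NormedRing B] [NormedAlgebra ℂ B] [CompleteSpace B]

/-- Along the exponents `2 ^ n` the sequence in Gelfand's formula is constant. -/
theorem spectralRadius_eq_nnnorm_of_forall_pow_two_pow {a : B}
    (h : ∀ n : ℕ, ‖a ^ 2 ^ n‖₊ = ‖a‖₊ ^ 2 ^ n) : spectralRadius ℂ a = ‖a‖₊ := by
  refine tendsto_nhds_unique ?_
    (tendsto_const_nhds (x := (‖a‖₊ : ℝ≥0∞)) (f := Filter.atTop (α := ℕ)))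
  convert! (spectrum.pow_nnnorm_pow_one_div_tendsto_nhds_spectralRadius a).comp
    (tendsto_pow_atTop_atTop_of_one_lt one_lt_two) using 1
  refine funext fun n => ?_
  rw [Function.comp_apply, h n, ENNReal.coe_pow, ← ENNReal.rpow_natCast, ← ENNReal.rpow_mul]
  simp

omit [NormedAlgebra ℂ B] [CompleteSpace B] in
-- The square identity is only asked on a set `S`, since the norm of the unitization need not
-- satisfy it.
theorem nnnorm_pow_two_pow_of_norm_mul_self {S : Set B} (hmul : ∀ z ∈ S, z * z ∈ S)
    (hsq : ∀ z ∈ S, ‖z * z‖ = ‖z‖ ^ 2) (n : ℕ) {z : B} (hz : z ∈ S) :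
    ‖z ^ 2 ^ n‖₊ = ‖z‖₊ ^ 2 ^ n := by
  induction n generalizing z with
  | zero => simp
  | succ n ih =>
    rw [pow_succ', pow_mul, pow_mul, sq, ih (hmul z hz)]
    congr 1
    exact NNReal.eq (by simpa using hsq z hz)

theorem spectralRadius_eq_nnnorm_of_norm_mul_self {S : Set B} (hmul : ∀ z ∈ S, z * z ∈ S)
    (hsq : ∀ z ∈ S, ‖z * z‖ = ‖z‖ ^ 2) {z : B} (hz : z ∈ S) :
    spectralRadius ℂ z = ‖z‖₊ :=
  spectralRadius_eq_nnnorm_of_forall_pow_two_pow fun n =>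
    nnnorm_pow_two_pow_of_norm_mul_self hmul hsq n hz

/-- An element whose conjugates stay bounded is central: this is Liouville's theorem applied to
`z ↦ exp (z x) y exp (-z x)`. -/
theorem commute_of_forall_norm_conj_le {y : B} {C : ℝ}
    (h : ∀ u : Bˣ, ‖(u : B) * y * (u⁻¹ : Bˣ)‖ ≤ C) (x : B) : Commute x y := by
  let _ : NormedAlgebra ℚ B := .restrictScalars ℚ ℂ B
  let f : ℂ → B := fun z => NormedSpace.exp (z • x) * y * NormedSpace.exp (z • (-x))
  have hf : Differentiable ℂ f := by unfold f; fun_prop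
  have hinv (z : ℂ) : NormedSpace.exp (z • (-x)) * NormedSpace.exp (z • x) = 1 := by
    rw [← NormedSpace.exp_add_of_commute (((Commute.refl x).neg_left.smul_left z).smul_right z)]
    simp
  have hinv' (z : ℂ) : NormedSpace.exp (z • x) * NormedSpace.exp (z • (-x)) = 1 := by
    rw [← NormedSpace.exp_add_of_commute (((Commute.refl x).neg_right.smul_left z).smul_right z)]
    simp
  have hb : Bornology.IsBounded (Set.range f) := by
    refine (Metric.isBounded_closedBall (x := (0 : B)) (r := C)).subset ?_
    rintro - ⟨z, rfl⟩
    rw [mem_closedBall_zero_iff]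
    exact h ⟨_, _, hinv' z, hinv z⟩
  have hconst (z : ℂ) : NormedSpace.exp (z • x) * y = y * NormedSpace.exp (z • x) := by
    have h0 : f z = y := by simpa [f] using hf.apply_eq_apply_of_bounded hb z 0
    calc NormedSpace.exp (z • x) * y = f z * NormedSpace.exp (z • x) := by
          simp only [f, mul_assoc, hinv, mul_one]
      _ = y * NormedSpace.exp (z • x) := by rw [h0]
  have hd : HasDerivAt (fun z : ℂ => NormedSpace.exp (z • x)) x 0 := by
    simpa using hasDerivAt_exp_smul_const x (0 : ℂ)
  -- Differentiating `exp (z x) y = y exp (z x)` at `z = 0` gives `x y = y x`.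
  refine (hd.mul_const y).unique ?_
  simpa only [hconst] using hd.const_mul y

theorem commute_of_norm_mul_self {S : Set B} (hl : ∀ b, ∀ z ∈ S, b * z ∈ S)
    (hr : ∀ b, ∀ z ∈ S, z * b ∈ S) (hsq : ∀ z ∈ S, ‖z * z‖ = ‖z‖ ^ 2) {y : B} (hy : y ∈ S)
    (x : B) : Commute x y := by
  have hrad {z : B} (hz : z ∈ S) : spectralRadius ℂ z = ‖z‖₊ :=
    spectralRadius_eq_nnnorm_of_norm_mul_self (fun z => hl z z) hsq hz
  refine commute_of_forall_norm_conj_le (C := ‖y‖) (fun u => le_of_eq ?_) x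
  have h := hrad (hr (u⁻¹ : Bˣ) _ (hl u y hy))
  rw [spectralRadius, spectrum.units_conjugate, ← spectralRadius, hrad hy] at h
  exact congrArg NNReal.toReal (ENNReal.coe_injective h).symm

end UniformNorm

/-! ### Characters of normed algebras with the square property. -/

section UniformNormedAlgebra

variable {A : Type*} [NonUnitalNormedRing A] [NormedSpace ℂ A] [IsScalarTower ℂ A A]
  [SMulCommClass ℂ A A]

/-- The Banach algebra obtained by completing the unitization of a normed algebra. -/
abbrev UnitizationCompletion (A : Type*) [NonUnitalNormedRing A] [NormedSpace ℂ A]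
    [IsScalarTower ℂ A A] [SMulCommClass ℂ A A] : Type _ :=
  UniformSpace.Completion (WithLp 1 (Unitization ℂ A))

namespace UnitizationCompletion

noncomputable instance : NormedAlgebra ℂ (UnitizationCompletion A) where
  norm_smul_le := norm_smul_le

/-- The isometric embedding of a normed algebra into the completion of its unitization. -/
noncomputable def embed : A →ₙₐ[ℂ] UnitizationCompletion A where
  toFun a := ((WithLp.toLp 1 (a : Unitization ℂ A) : WithLp 1 (Unitization ℂ A)) :
    UnitizationCompletion A)
  map_smul' c a := by
    rw [Unitization.inr_smul, WithLp.toLp_smul, UniformSpace.Completion.coe_smul]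
    rfl
  map_zero' := by
    rw [Unitization.inr_zero, WithLp.toLp_zero, UniformSpace.Completion.coe_zero]
  map_add' a b := by
    rw [Unitization.inr_add, WithLp.toLp_add, UniformSpace.Completion.coe_add]
  map_mul' a b := by
    rw [← UniformSpace.Completion.coe_mul, Unitization.inr_mul]
    rfl

theorem norm_embed (a : A) : ‖embed a‖ = ‖a‖ :=
  (UniformSpace.Completion.norm_coe _).trans (WithLp.unitization_norm_inr a)

theorem coe_eq_algebraMap_add_embed (u : WithLp 1 (Unitization ℂ A)) :
    (u : UnitizationCompletion A) =
      algebraMap ℂ (UnitizationCompletion A) (WithLp.ofLp u).fst + embed (WithLp.ofLp u).snd := by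
  change _ = ((algebraMap ℂ (WithLp 1 (Unitization ℂ A)) (WithLp.ofLp u).fst :
    WithLp 1 (Unitization ℂ A)) : UnitizationCompletion A) + ((WithLp.toLp 1
      ((WithLp.ofLp u).snd : Unitization ℂ A) : WithLp 1 (Unitization ℂ A)) :
    UnitizationCompletion A)
  rw [← UniformSpace.Completion.coe_add]
  congr 1
  exact congrArg (WithLp.toLp 1) (Unitization.inl_fst_add_inr_snd_eq (WithLp.ofLp u)).symm

/-- By density `b` may be taken of the form scalar plus element of `A`, and such elements multiply
`A` into itself. -/
theorem mul_mem_closure_range_embed (b z : UnitizationCompletion A)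
    (hz : z ∈ closure (Set.range (embed (A := A)))) :
    b * z ∈ closure (Set.range (embed (A := A))) := by
  refine map_mem_closure₂ continuous_mul (UniformSpace.Completion.denseRange_coe b) hz ?_
  rintro - ⟨u, rfl⟩ - ⟨a, rfl⟩
  refine ⟨(WithLp.ofLp u).fst • a + (WithLp.ofLp u).snd * a, ?_⟩
  rw [coe_eq_algebraMap_add_embed, add_mul, map_add, map_smul, map_mul, Algebra.smul_def]

theorem mul_mem_closure_range_embed' (b z : UnitizationCompletion A)
    (hz : z ∈ closure (Set.range (embed (A := A)))) :
    z * b ∈ closure (Set.range (embed (A := A))) := by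
  refine map_mem_closure₂ continuous_mul hz (UniformSpace.Completion.denseRange_coe b) ?_
  rintro - ⟨a, rfl⟩ - ⟨u, rfl⟩
  refine ⟨(WithLp.ofLp u).fst • a + a * (WithLp.ofLp u).snd, ?_⟩
  rw [coe_eq_algebraMap_add_embed, mul_add, map_add, map_smul, map_mul, Algebra.smul_def,
    Algebra.commutes]

theorem norm_mul_self_of_mem_closure (hA : ∀ a : A, ‖a * a‖ = ‖a‖ ^ 2) :
    ∀ z ∈ closure (Set.range (embed (A := A))), ‖z * z‖ = ‖z‖ ^ 2 := by
  refine closure_minimal ?_ (isClosed_eq (by fun_prop) (by fun_prop))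
  rintro - ⟨a, rfl⟩
  change ‖embed a * embed a‖ = ‖embed a‖ ^ 2
  rw [← map_mul, norm_embed, norm_embed, hA]

theorem mul_comm_of_norm_mul_self (hA : ∀ a : A, ‖a * a‖ = ‖a‖ ^ 2)
    (x y : UnitizationCompletion A) : x * y = y * x := by
  induction y using UniformSpace.Completion.induction_on with
  | hp => exact isClosed_eq (by fun_prop) (by fun_prop)
  | ih u =>
    rw [coe_eq_algebraMap_add_embed]
    exact (Algebra.commute_algebraMap_right _ _).add_right
      (commute_of_norm_mul_self mul_mem_closure_range_embed mul_mem_closure_range_embed'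
        (norm_mul_self_of_mem_closure hA) (subset_closure ⟨_, rfl⟩) x)

theorem spectralRadius_embed (hA : ∀ a : A, ‖a * a‖ = ‖a‖ ^ 2) (a : A) :
    spectralRadius ℂ (embed a) = ‖a‖₊ := by
  rw [spectralRadius_eq_nnnorm_of_norm_mul_self
    (fun z => mul_mem_closure_range_embed z z) (norm_mul_self_of_mem_closure hA)
    (subset_closure ⟨a, rfl⟩)]
  exact congrArg _ (NNReal.eq (norm_embed a))

end UnitizationCompletion

open UnitizationCompletion in
/-- The contractive characters of a normed algebra with `‖a * a‖ = ‖a‖ ^ 2` separate its points. -/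
theorem exists_mem_characterSpace_apply_ne_zero (hA : ∀ a : A, ‖a * a‖ = ‖a‖ ^ 2) {a : A}
    (ha : a ≠ 0) :
    ∃ χ ∈ WeakDual.characterSpace ℂ A, χ a ≠ 0 ∧ ∀ x, ‖χ x‖ ≤ ‖x‖ := by
  let _ : NormedCommRing (UnitizationCompletion A) :=
    { (inferInstance : NormedRing (UnitizationCompletion A)) with
      mul_comm := mul_comm_of_norm_mul_self hA }
  have hne : embed a ≠ 0 := by
    rw [← norm_ne_zero_iff, norm_embed]
    exact norm_ne_zero_iff.2 ha
  have : Nontrivial (UnitizationCompletion A) := ⟨⟨_, _, hne⟩⟩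
  -- A spectral value of maximal modulus, here `‖a‖ ≠ 0`; by commutativity it is the value of a
  -- character at `embed a`.
  obtain ⟨z, hz, hza⟩ := spectrum.exists_nnnorm_eq_spectralRadius (embed a)
  obtain ⟨φ, hφ⟩ := WeakDual.CharacterSpace.mem_spectrum_iff_exists.1 hz
  have hle (x : A) : ‖φ (embed x)‖ ≤ ‖x‖ := by
    have h : (‖φ (embed x)‖₊ : ℝ≥0∞) ≤ spectralRadius ℂ (embed x) :=
      le_iSup₂ (f := fun (k : ℂ) (_ : k ∈ spectrum ℂ (embed x)) => (‖k‖₊ : ℝ≥0∞)) (φ (embed x))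
        (WeakDual.CharacterSpace.mem_spectrum_iff_exists.2 ⟨φ, rfl⟩)
    rw [spectralRadius_embed hA] at h
    exact_mod_cast h
  let χ : WeakDual ℂ A := LinearMap.mkContinuous
    { toFun := fun x => φ (embed x)
      map_add' := fun x y => by rw [map_add, map_add]
      map_smul' := fun c x => by rw [map_smul, map_smul, RingHom.id_apply] } 1
    (fun x => by rw [one_mul]; exact hle x)
  have hχ (x : A) : χ x = φ (embed x) := rfl
  have hχa : χ a ≠ 0 := by
    rw [hχ, hφ, ← nnnorm_ne_zero_iff]
    rw [spectralRadius_embed hA, ENNReal.coe_inj] at hza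
    rw [hza]
    exact nnnorm_ne_zero_iff.2 ha
  refine ⟨χ, ⟨fun h => hχa (by rw [h]; rfl), fun x y => ?_⟩, hχa, fun x => hle x⟩
  rw [hχ, hχ, hχ, map_mul, map_mul]

end UniformNormedAlgebra

/-! ### Transfer to uniform topological algebras. -/

namespace UniformSeminorm

variable {E : Type*} [NonUnitalRing E] [Module ℂ E]

theorem norm_factor_mul_self (p : UniformSeminorm E) (a : p.Factor) : ‖a * a‖ = ‖a‖ ^ 2 := by
  obtain ⟨x, rfl⟩ := p.toFactor_surjective a
  exact p.sq' x

theorem exists_mem_boundedCharacters_apply_ne_zero [IsScalarTower ℂ E E] [SMulCommClass ℂ E E]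
    [TopologicalSpace E] [IsTopologicalAddGroup E] (p : UniformSeminorm E)
    (hp : Continuous p.toSeminorm) {x : E} (hx : p x ≠ 0) :
    ∃ χ ∈ p.boundedCharacters, χ x ≠ 0 := by
  have hx' : p.toFactor x ≠ 0 := norm_ne_zero_iff.1 hx
  obtain ⟨μ, hμ, hμx, hμle⟩ := exists_mem_characterSpace_apply_ne_zero p.norm_factor_mul_self hx'
  have hcont : Continuous p.quotientHom := by
    refine continuous_of_continuousAt_zero p.quotientHom ?_
    rw [ContinuousAt, map_zero, tendsto_zero_iff_norm_tendsto_zero]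
    have h := hp.tendsto 0
    rw [map_zero] at h
    exact h
  let χ : WeakDual ℂ E :=
    (⟨(μ : p.Factor →ₗ[ℂ] ℂ) ∘ₗ (p.quotientHom : E →ₗ[ℂ] p.Factor),
      (map_continuous μ).comp hcont⟩ : E →L[ℂ] ℂ)
  have hχ (y : E) : χ y = μ (p.toFactor y) := rfl
  refine ⟨χ, ⟨⟨fun h => hμx ?_, fun y z => ?_⟩, fun y => hμle _⟩, hμx⟩
  · rw [← hχ, h]
    rfl
  · rw [hχ, hχ, hχ, toFactor_mul, hμ.2]

end UniformSeminorm

theorem proposition2p7 {E : Type*} {Λ : Type*} [NonUnitalRing E] [Module ℂ E]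
    [IsScalarTower ℂ E E] [SMulCommClass ℂ E E] [TopologicalSpace E]
    (p : Λ → UniformSeminorm E) (hE : IsUniformTopologicalAlgebra p) :
    (∀ α : Λ, LinearMap.ker ((p α).quotientHom : E →ₗ[ℂ] (p α).Factor) =
      ⨅ χ ∈ (p α).boundedCharacters, LinearMap.ker (χ : E →ₗ[ℂ] ℂ)) ∧
    ∀ (α β : Λ) (h : ∀ x, p α x ≤ p β x),
      LinearMap.ker (UniformSeminorm.transitionHom h : (p β).Factor →ₗ[ℂ] (p α).Factor) =
        ⨅ μ ∈ WeakDual.characterSpace ℂ (p α).Factor,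
          LinearMap.ker ((μ : (p α).Factor →ₗ[ℂ] ℂ) ∘ₗ
            (UniformSeminorm.transitionHom h : (p β).Factor →ₗ[ℂ] (p α).Factor)) := by
  have := hE.isTopologicalAddGroup
  refine ⟨fun α => ?_, fun α β h => ?_⟩
  · ext x
    simp only [LinearMap.mem_ker, Submodule.mem_iInf]
    refine ⟨fun hx χ hχ => ?_, fun hx => ?_⟩
    · have hx0 : (p α).toFactor x = 0 := hx
      have h0 : p α x = 0 := norm_eq_zero.2 hx0
      exact norm_le_zero_iff.1 ((hχ.2 x).trans h0.le)
    -- This also covers an empty set of characters: `hx` is then vacuous, and the character obtained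
    -- below is itself the contradiction.
    · by_contra hne
      have hne' : p α x ≠ 0 := fun h0 => hne (norm_eq_zero.1 h0 : (p α).toFactor x = 0)
      obtain ⟨χ, hχ, hχx⟩ := (p α).exists_mem_boundedCharacters_apply_ne_zero
        (hE.withSeminorms.continuous_seminorm α) hne'
      exact hχx (hx χ hχ)
  · ext a
    simp only [LinearMap.mem_ker, Submodule.mem_iInf, LinearMap.comp_apply]
    refine ⟨fun ha μ _ => by rw [ha, map_zero], fun ha => ?_⟩
    by_contra hne
    obtain ⟨μ, hμ, hμa, -⟩ :=
      exists_mem_characterSpace_apply_ne_zero (p α).norm_factor_mul_self hne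
    exact hμa (ha μ hμ)
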